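/- Let $k$ be a field. All $k$-algebras are $k$-vector spaces with a bilinear multiplication, not assumed associative or unital. **Conventions.** A *monomial* is a nonempty bracketed product of indeterminates (repetitions allowed); its *length* is the number of letters in it. The *submonomials* of $w$ are $w$ itself and, if $w=w'w''$, the submonomials of $w'$ and of $w''$. For natural numbers $n\le N$, a monomial $w$ is *$[n,N]$-separating* if for some $m$ with $n\le m\le N$ it has a submonomial of length exactly $\mathrm{length}(w)-m$. A *variety* of $k$-algebras is the class of all $k$-algebras satisfying a given set of identities, an identity being the statement that a given $k$-linear combination of monomials vanishes under all evaluations; an identity is *homogeneous* if all monomials occurring in it have the same number of occurrences of each indeterminate. A variety $\mathbf V$ is *$[1,1+d]$-separative* if for every monomial $w$ of length $>1$, $\mathbf V$ satisfies a homogeneous identity equating $w$ with a $k$-linear combination of $[1,1+d]$-separating monomials; $\mathbf V$ is *separative* if it is $[1,1+d]$-separative for some natural number $d$. For an algebra $A$, define subspaces $A_{(n)}$ ($n\ge 1$) by $A_{(1)}=A$ and $A_{(n+1)}=\sum_{0<m<n+1}A_{(m)}A_{(n+1-m)}$, where $BC$ denotes the span of all products $bc$ $(b\in B,\ c\in C)$;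 $A$ is *nilpotent* if $A_{(n)}=\{0\}$ for some $n\ge 1$. **Theorem 4.1.** Let $\mathbf V$ be a separative variety of $k$-algebras, and let $A\in\mathbf V$ be the inverse limit of an inversely directed system $(A_i)_{i\in I}$ of finite-dimensional $k$-algebras and algebra homomorphisms. Give $A$ the inverse limit topology of the discrete topologies on the $A_i$ (the coarsest topology making all projections $A\to A_i$ continuous), and suppose that $A$ has a finitely generated subalgebra $S$ which is dense in this topology. Then: (i) For all $n>0$, $A_{(n)}$ is open in the inverse limit topology on $A$. (ii) Every homomorphism from $A$ to a nilpotent $k$-algebra $B$ is continuous, with respect to the discrete topology on $B$. (iii) If all the $A_i$ are nilpotent, then every homomorphism from $A$ to a finite-dimensional $k$-algebra $B$ is continuous, with respect to the discrete topology on $B$. -/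

import Mathlib

/-!
Algebras over a field `k` are neither unital nor associative: a type `A` with
`[NonUnitalNonAssocRing A] [Module k A] [IsScalarTower k A A] [SMulCommClass k A A]`.
Homomorphisms are `A →ₙₐ[k] B`.  Monomials in indeterminates `x : X` are the elements of
`FreeMagma X`, and `FreeMagma.length` is their length.  -/

open scoped Topology

namespace NonAssocAlg

universe u v

section Powers

variable (k : Type u) [Field k] (A : Type v) [NonUnitalNonAssocRing A] [Module k A]
  [IsScalarTower k A A] [SMulCommClass k A A]

/-- The subspaces `A_(n)`: `A_(1) = A` and, for `n ≥ 2`, `A_(n) = ∑_{0 < m < n} A_(m) A_(n - m)`,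
where the product `B C` of two subspaces is the span of the products `b * c`.
(By convention `A_(0) = A`; only `n ≥ 1` is meaningful.) -/
def lowerPower : ℕ → Submodule k A
  | 0 => ⊤
  | 1 => ⊤
  | n + 2 => ⨆ m : Fin (n + 1),
      Submodule.map₂ (LinearMap.mul k A) (lowerPower (m + 1)) (lowerPower (n + 1 - m))

/-- An algebra is nilpotent if `A_(n) = 0` for some `n ≥ 1`. -/
def IsNilpotentAlg : Prop :=
  ∃ n : ℕ, 1 ≤ n ∧ lowerPower k A n = ⊥

/-- Agreement of the recursion with the formula `A_(n) = ∑_{0 < m < n} A_(m) A_(n - m)`. -/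
theorem lowerPower_eq (n : ℕ) (hn : 2 ≤ n) :
    lowerPower k A n = ⨆ (m : ℕ) (_ : 0 < m ∧ m < n),
      Submodule.map₂ (LinearMap.mul k A) (lowerPower k A m) (lowerPower k A (n - m)) := by
  obtain ⟨n, rfl⟩ := Nat.exists_eq_add_of_le' hn
  rw [lowerPower]
  apply le_antisymm
  · refine iSup_le fun m => ?_
    have h : n + 1 - (m : ℕ) = n + 2 - (m + 1) := by omega
    rw [h]
    exact le_iSup₂_of_le (m + 1 : ℕ) ⟨by omega, by omega⟩ le_rfl
  · refine iSup₂_le fun m hm => ?_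
    obtain ⟨m, rfl⟩ := Nat.exists_eq_add_of_le' hm.1
    have h : n + 2 - (m + 1) = n + 1 - m := by omega
    rw [h]
    exact le_iSup_of_le (⟨m, by omega⟩ : Fin (n + 1)) le_rfl

end Powers

section Monomials

variable {X : Type u}

/-- `IsSubmonomial v w`: `v` is a submonomial of `w`.  The submonomials of `w = a * b` are `w`
itself and the submonomials of `a` and of `b`. -/
def IsSubmonomial (v : FreeMagma X) : FreeMagma X → Prop
  | .of x => v = .of x
  | .mul a b => v = .mul a b ∨ IsSubmonomial v a ∨ IsSubmonomial v b

/-- `w` is `m`-separating if it has a submonomial of length exactly `length w - m`. -/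
def IsSeparating (m : ℕ) (w : FreeMagma X) : Prop :=
  ∃ v : FreeMagma X, IsSubmonomial v w ∧ v.length + m = w.length

/-- `w` is `[n, N]`-separating if it is `m`-separating for some `m ∈ [n, N]`. -/
def IsIntervalSeparating (n N : ℕ) (w : FreeMagma X) : Prop :=
  ∃ m : ℕ, n ≤ m ∧ m ≤ N ∧ IsSeparating m w

/-- The indeterminates of a monomial, with the number of occurrences of each. -/
def multidegree : FreeMagma X → Multiset X
  | .of x => {x}
  | .mul a b => multidegree a + multidegree b

/-- A linear combination of monomials is homogeneous if all monomials that occur in it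
have the same number of occurrences of each indeterminate. -/
def IsHomogeneous {k : Type v} [Field k] (p : FreeNonUnitalNonAssocAlgebra k X) : Prop :=
  ∃ D : Multiset X, ∀ w ∈ p.coeff.support, multidegree w = D

end Monomials

/-- The algebra `A` satisfies the identity `p = 0`: all evaluations of `p` in `A` vanish. -/
def SatisfiesIdentity {k : Type u} [Field k] (A : Type v) [NonUnitalNonAssocRing A] [Module k A]
    [IsScalarTower k A A] [SMulCommClass k A A] (p : FreeNonUnitalNonAssocAlgebra k ℕ) : Prop :=
  ∀ a : ℕ → A, FreeNonUnitalNonAssocAlgebra.lift k a p = 0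

/-- A variety of `k`-algebras, presented by a set of defining identities `p = 0` in
countably many indeterminates. -/
structure Variety (k : Type u) [Field k] where
  /-- the defining identities -/
  identities : Set (FreeNonUnitalNonAssocAlgebra k ℕ)

namespace Variety

variable {k : Type u} [Field k] (V : Variety k)

/-- Membership of an algebra in the variety: it satisfies all defining identities. -/
def Mem (A : Type v) [NonUnitalNonAssocRing A] [Module k A]
    [IsScalarTower k A A] [SMulCommClass k A A] : Prop :=
  ∀ p ∈ V.identities, SatisfiesIdentity A p

/-- `p = 0` is an identity of the variety: it holds in all its members.  (Members in the universe
of `k` suffice, as the free algebra of the variety on `ℕ` lies there.) -/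
def HasIdentity (p : FreeNonUnitalNonAssocAlgebra k ℕ) : Prop :=
  ∀ (B : Type u) [NonUnitalNonAssocRing B] [Module k B] [IsScalarTower k B B]
    [SMulCommClass k B B], V.Mem B → SatisfiesIdentity B p

/-- The variety is `[1, 1 + d]`-separative: every monomial `w` of length `> 1` is equated, by a
homogeneous identity of the variety, with a linear combination `p` of
`[1, 1 + d]`-separating monomials. -/
def IsIntervalSeparative (d : ℕ) : Prop :=
  ∀ w : FreeMagma ℕ, 1 < w.length →
    ∃ p : FreeNonUnitalNonAssocAlgebra k ℕ,
      (∀ v ∈ p.coeff.support, IsIntervalSeparating 1 (1 + d) v) ∧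
      IsHomogeneous (MonoidAlgebra.single w 1 - p) ∧
      V.HasIdentity (MonoidAlgebra.single w 1 - p)

/-- The variety is separative: `[1, 1 + d]`-separative for some natural number `d`. -/
def IsSeparative : Prop :=
  ∃ d : ℕ, V.IsIntervalSeparative d

end Variety

section InverseLimits

variable {k : Type u} [Field k] {I : Type*} {F : I → Type*}
  [∀ i, NonUnitalNonAssocRing (F i)] [∀ i, Module k (F i)]
  {A : Type*} [NonUnitalNonAssocRing A] [Module k A]

/-- `A`, with the projections `π i : A → F i`, is an inverse limit of the system of algebras
`F i` with connecting homomorphisms `φ h : F j → F i` for `h : i ≤ j`: the projections are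
compatible, and every compatible family of elements comes from exactly one element of `A`. -/
structure IsInverseLimit [Preorder I] (φ : ∀ ⦃i j : I⦄, i ≤ j → (F j →ₙₐ[k] F i))
    (π : ∀ i, A →ₙₐ[k] F i) : Prop where
  inverseSystem : InverseSystem (fun i j (h : i ≤ j) => (φ h : F j → F i))
  compatible : ∀ ⦃i j : I⦄ (h : i ≤ j) (a : A), φ h (π j a) = π i a
  existsUnique : ∀ x : ∀ i, F i, (∀ ⦃i j : I⦄ (h : i ≤ j), φ h (x j) = x i) →
    ∃! a : A, ∀ i, π i a = x i

/-- The inverse limit topology on `A`: the coarsest topology for which all projections to the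
`F i`, taken with their discrete topologies, are continuous. -/
abbrev inverseLimitTopology (π : ∀ i, A →ₙₐ[k] F i) : TopologicalSpace A :=
  ⨅ i, TopologicalSpace.induced (π i) ⊥

end InverseLimits

end NonAssocAlg

/-! For (i), iterating separativity from finitely many generators writes every monomial of length at
least `n` as a combination of values `T v`, where `v` is a monomial and `T` is a composition of
multiplications of total length in `[n - 1, n - 1 + d]` (`lift_mem_of_lt`). These operators span a
finite-dimensional space, say with generators `T j`, and `∑ T j A` lies in `A_(n)`. By linear
compactness of `A`, which is the full dual of its continuous dual (`exists_eval`), that sum is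
closed (`exists_eq_sum`). The long monomials are dense in `A_(n)`, so `A_(n) = ∑ T j A` is closed.
Together with the finitely many short monomials it spans a dense subspace, so it has finite
codimension and is open (`exists_ker_le`).

Part (ii) follows, since a homomorphism maps `A_(n)` into `B_(n)`.

For (iii) it suffices that the image of `A` is nilpotent. Otherwise the image `B` has a subspace `C
= B C + C B ≠ 0`, and generators of `C` solve a homogeneous linear system `c = M c`. Lift the
coefficients of `M` to `A`: there `1 - M` is surjective, because it is bijective over each nilpotent
`F i` and the unique solutions glue. So `1 - M` is surjective over `B`, hence injective by finite
dimension, and `c = 0`. -/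

namespace NonAssocAlg

universe u

/-! ### Identities of a variety across universes -/

section Identities

variable {k : Type u} [Field k] {A : Type*} [NonUnitalNonAssocRing A] [Module k A]
  [IsScalarTower k A A] [SMulCommClass k A A]

theorem lift_apply_eq_sum {X : Type*} (a : X → A) (p : FreeNonUnitalNonAssocAlgebra k X) :
    FreeNonUnitalNonAssocAlgebra.lift k a p =
      p.coeff.sum fun w c => c • FreeMagma.lift a w := by
  simp [FreeNonUnitalNonAssocAlgebra.lift, MonoidAlgebra.liftMagma_apply_apply]
  rfl

theorem SatisfiesIdentity.of_injective {B : Type*} [NonUnitalNonAssocRing B] [Module k B]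
    [IsScalarTower k B B] [SMulCommClass k B B] (g : B →ₙₐ[k] A) (hg : Function.Injective g)
    {p : FreeNonUnitalNonAssocAlgebra k ℕ} (h : SatisfiesIdentity A p) :
    SatisfiesIdentity B p := by
  intro b
  apply hg
  have : g.comp (FreeNonUnitalNonAssocAlgebra.lift k b) =
      FreeNonUnitalNonAssocAlgebra.lift k (g ∘ b) := by
    rw [← FreeNonUnitalNonAssocAlgebra.lift_unique]
    ext x
    simp
  rw [map_zero, ← h (g ∘ b), ← this]
  rfl

/-- An algebra whose underlying type is small has a copy in the small universe. -/
theorem exists_copy_of_small [Small.{u} A] :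
    ∃ (B : Type u) (_ : NonUnitalNonAssocRing B) (_ : Module k B) (_ : IsScalarTower k B B)
      (_ : SMulCommClass k B B) (g : B →ₙₐ[k] A), Function.Bijective g := by
  let e : Shrink.{u} A ≃+* A := Shrink.ringEquiv A
  let l : Shrink.{u} A ≃ₗ[k] A := Shrink.linearEquiv k A
  have hl : ∀ x, l x = e x := fun x => rfl
  have hs : ∀ (c : k) x, e (c • x) = c • e x := fun c x => by rw [← hl, ← hl, map_smul]
  refine ⟨Shrink.{u} A, inferInstance, inferInstance, ⟨fun c x y => ?_⟩, ⟨fun c x y => ?_⟩,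
    { toFun := e, map_smul' := hs, map_zero' := map_zero e, map_add' := map_add e,
      map_mul' := map_mul e }, e.bijective⟩
  · apply e.injective
    simp only [smul_eq_mul, map_mul, hs, smul_mul_assoc]
  · apply e.injective
    simp only [smul_eq_mul, map_mul, hs, mul_smul_comm]

/-- `HasIdentity` tests only algebras in the universe of `k`. An evaluation in `A` takes place in a
countably generated subalgebra, which is small and so has a copy there. -/
theorem Variety.HasIdentity.satisfiesIdentity {V : Variety k}
    {p : FreeNonUnitalNonAssocAlgebra k ℕ} (hp : V.HasIdentity p) (hA : V.Mem A) :
    SatisfiesIdentity A p := by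
  intro a
  set f := FreeNonUnitalNonAssocAlgebra.lift k a with hf
  let R : NonUnitalSubalgebra k A := NonUnitalAlgHom.range f
  have : Small.{u} R := small_range f
  obtain ⟨B, _, _, _, _, g, hg⟩ := exists_copy_of_small (k := k) (A := R)
  let h : B →ₙₐ[k] A := (NonUnitalSubalgebraClass.subtype R).comp g
  have hinj : Function.Injective h := Subtype.val_injective.comp hg.1
  have hB : SatisfiesIdentity B p :=
    hp B fun q hq => SatisfiesIdentity.of_injective h hinj (hA q hq)
  have hmem : ∀ n, ∃ b : B, h b = a n := fun n => by
    obtain ⟨b, hb⟩ := hg.2 ⟨a n, ⟨FreeNonUnitalNonAssocAlgebra.of k n,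
      FreeNonUnitalNonAssocAlgebra.lift_of_apply k a n⟩⟩
    exact ⟨b, by simp [h, hb]⟩
  choose b hb using hmem
  have : h.comp (FreeNonUnitalNonAssocAlgebra.lift k b) = f := by
    rw [hf, ← FreeNonUnitalNonAssocAlgebra.lift_unique]
    ext x
    simp [hb]
  rw [← this]
  change h (FreeNonUnitalNonAssocAlgebra.lift k b p) = 0
  rw [hB b, map_zero]

end Identities

/-! ### The powers `A_(n)` -/

section LowerPowers

variable {k : Type u} [Field k] {A : Type*} [NonUnitalNonAssocRing A] [Module k A]
  [IsScalarTower k A A] [SMulCommClass k A A]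

theorem lowerPower_one : lowerPower k A 1 = ⊤ := by rw [lowerPower]

theorem mul_mem_lowerPower {m n : ℕ} (hm : 0 < m) (hn : 0 < n) {x y : A}
    (hx : x ∈ lowerPower k A m) (hy : y ∈ lowerPower k A n) : x * y ∈ lowerPower k A (m + n) := by
  rw [lowerPower_eq k A (m + n) (by omega)]
  refine Submodule.mem_iSup_of_mem m (Submodule.mem_iSup_of_mem ⟨hm, by omega⟩ ?_)
  rw [Nat.add_sub_cancel_left]
  exact Submodule.apply_mem_map₂ _ hx hy

theorem lowerPower_le_of_mul_mem {n : ℕ} (hn : 2 ≤ n) {N : Submodule k A}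
    (h : ∀ i j, 0 < i → 0 < j → i + j = n → ∀ x ∈ lowerPower k A i, ∀ y ∈ lowerPower k A j,
      x * y ∈ N) : lowerPower k A n ≤ N := by
  rw [lowerPower_eq k A n hn]
  refine iSup₂_le fun m hm => Submodule.map₂_le.2 fun x hx y hy => ?_
  exact h m (n - m) hm.1 (by omega) (by omega) x hx y hy

/-- In a product of total degree at least 3, some factor has degree at least 2, and induction lowers
that degree by one. -/
theorem lowerPower_succ_le (n : ℕ) : lowerPower k A (n + 1) ≤ lowerPower k A n := by
  induction n using Nat.strong_induction_on with
  | _ n ih =>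
    match n with
    | 0 => rw [lowerPower]; exact le_top
    | 1 => rw [lowerPower_one]; exact le_top
    | n + 2 =>
      refine lowerPower_le_of_mul_mem (by omega) fun i j hi hj hij x hx y hy => ?_
      rcases Nat.lt_or_ge 1 i with h | h
      · obtain ⟨i, rfl⟩ := Nat.exists_eq_add_of_le' h
        have := mul_mem_lowerPower (by omega) hj (ih (i + 1) (by omega) hx) hy
        rwa [show i + 1 + j = n + 2 by omega] at this
      · obtain ⟨j, rfl⟩ := Nat.exists_eq_add_of_le' hj
        have := mul_mem_lowerPower hi (n := j) (by omega) hx (ih j (by omega) hy)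
        rwa [show i + j = n + 2 by omega] at this

theorem lowerPower_antitone : Antitone (lowerPower k A) :=
  antitone_nat_of_succ_le lowerPower_succ_le

theorem map_mem_lowerPower {B : Type*} [NonUnitalNonAssocRing B] [Module k B]
    [IsScalarTower k B B] [SMulCommClass k B B] (f : A →ₙₐ[k] B) (n : ℕ) :
    ∀ x ∈ lowerPower k A n, f x ∈ lowerPower k B n := by
  induction n using Nat.strong_induction_on with
  | _ n ih =>
    match n with
    | 0 => intro x _; rw [lowerPower]; trivial
    | 1 => intro x _; rw [lowerPower]; trivial
    | n + 2 =>
      suffices lowerPower k A (n + 2) ≤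
          (lowerPower k B (n + 2)).comap (f : A →ₗ[k] B) from fun x hx => this hx
      refine lowerPower_le_of_mul_mem (by omega) fun i j hi hj hij x hx y hy => ?_
      have := mul_mem_lowerPower hi hj (ih i (by omega) x hx) (ih j (by omega) y hy)
      rw [hij, ← map_mul] at this
      exact this

end LowerPowers

/-! ### Degrees of monomials -/

section Monomials

variable {X : Type*}

theorem card_multidegree (w : FreeMagma X) : (multidegree w).card = w.length := by
  induction w with
  | ih1 x => simp [multidegree]
  | ih2 a b ha hb =>
    change (multidegree a + multidegree b).card = a.length + b.length
    simp [ha, hb]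

theorem IsHomogeneous.length_eq {k : Type*} [Field k] {p : FreeNonUnitalNonAssocAlgebra k X}
    (hp : IsHomogeneous p) {v w : FreeMagma X} (hv : v ∈ p.coeff.support)
    (hw : w ∈ p.coeff.support) : v.length = w.length := by
  obtain ⟨D, hD⟩ := hp
  rw [← card_multidegree, ← card_multidegree, hD v hv, hD w hw]

end Monomials

/-! ### Multiplication operators graded by length -/

section Operators

variable {k : Type u} [Field k] {A : Type*} [NonUnitalNonAssocRing A] [Module k A]
  [IsScalarTower k A A] [SMulCommClass k A A]

/-- The span of the values of all monomials of length `n` at elements of `G`. -/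
def monomialSpan (G : Submodule k A) : ℕ → Submodule k A
  | 0 => ⊥
  | 1 => G
  | n + 2 => ⨆ m : Fin (n + 1),
      Submodule.map₂ (LinearMap.mul k A) (monomialSpan G (m + 1)) (monomialSpan G (n + 1 - m))

/-- The span of the compositions of left and right multiplications by monomials in elements of `G`
whose lengths add up to `n`. -/
def operatorSpan (G : Submodule k A) : ℕ → Submodule k (Module.End k A)
  | 0 => Submodule.span k {1}
  | n + 1 => ⨆ m : Fin (n + 1),
      ((monomialSpan G (m + 1)).map (LinearMap.mul k A) ⊔
        (monomialSpan G (m + 1)).map (LinearMap.mul k A).flip) * operatorSpan G (n - m)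

variable {G : Submodule k A}

theorem monomialSpan_fg (hG : G.FG) (n : ℕ) : (monomialSpan G n).FG := by
  induction n using Nat.strong_induction_on with
  | _ n ih =>
    match n with
    | 0 => rw [monomialSpan]; exact Submodule.fg_bot
    | 1 => rw [monomialSpan]; exact hG
    | n + 2 =>
      rw [monomialSpan]
      exact Submodule.fg_iSup _ fun m => (ih _ (by omega)).map₂ _ (ih _ (by omega))

/-- This finiteness turns a bounded window of operator lengths into finitely many operators. -/
theorem operatorSpan_fg (hG : G.FG) (n : ℕ) : (operatorSpan G n).FG := by
  induction n using Nat.strong_induction_on with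
  | _ n ih =>
    match n with
    | 0 => rw [operatorSpan]; exact Submodule.fg_span (Set.finite_singleton _)
    | n + 1 =>
      rw [operatorSpan]
      exact Submodule.fg_iSup _ fun m =>
        (((monomialSpan_fg hG _).map _).sup ((monomialSpan_fg hG _).map _)).mul (ih _ (by omega))

theorem mul_mem_monomialSpan {m n : ℕ} (hm : 0 < m) (hn : 0 < n) {x y : A}
    (hx : x ∈ monomialSpan G m) (hy : y ∈ monomialSpan G n) : x * y ∈ monomialSpan G (m + n) := by
  obtain ⟨m, rfl⟩ := Nat.exists_eq_add_of_le' hm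
  obtain ⟨n, rfl⟩ := Nat.exists_eq_add_of_le' hn
  rw [show m + 1 + (n + 1) = m + n + 2 by omega, monomialSpan]
  refine Submodule.mem_iSup_of_mem ⟨m, by omega⟩ ?_
  rw [show m + n + 1 - m = n + 1 by omega]
  exact Submodule.apply_mem_map₂ _ hx hy

theorem mulLeft_mul_mem_operatorSpan {m n : ℕ} (hm : 0 < m) {x : A} (hx : x ∈ monomialSpan G m)
    {T : Module.End k A} (hT : T ∈ operatorSpan G n) :
    LinearMap.mul k A x * T ∈ operatorSpan G (m + n) := by
  obtain ⟨m, rfl⟩ := Nat.exists_eq_add_of_le' hm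
  rw [show m + 1 + n = m + n + 1 by omega, operatorSpan]
  refine Submodule.mem_iSup_of_mem ⟨m, by omega⟩ ?_
  rw [show m + n - m = n by omega]
  exact Submodule.mul_mem_mul (Submodule.mem_sup_left (Submodule.mem_map_of_mem hx)) hT

theorem mulRight_mul_mem_operatorSpan {m n : ℕ} (hm : 0 < m) {x : A} (hx : x ∈ monomialSpan G m)
    {T : Module.End k A} (hT : T ∈ operatorSpan G n) :
    (LinearMap.mul k A).flip x * T ∈ operatorSpan G (m + n) := by
  obtain ⟨m, rfl⟩ := Nat.exists_eq_add_of_le' hm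
  rw [show m + 1 + n = m + n + 1 by omega, operatorSpan]
  refine Submodule.mem_iSup_of_mem ⟨m, by omega⟩ ?_
  rw [show m + n - m = n by omega]
  exact Submodule.mul_mem_mul (Submodule.mem_sup_right (Submodule.mem_map_of_mem hx)) hT

theorem operatorSpan_le_of_mul_mem {n : ℕ} {N : Submodule k (Module.End k A)}
    (h : ∀ i j, 0 < i → i + j = n + 1 → ∀ x ∈ monomialSpan G i, ∀ T ∈ operatorSpan G j,
      LinearMap.mul k A x * T ∈ N ∧ (LinearMap.mul k A).flip x * T ∈ N) :
    operatorSpan G (n + 1) ≤ N := by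
  rw [operatorSpan]
  refine iSup_le fun m => ?_
  rw [Submodule.sup_mul, sup_le_iff]
  constructor <;> rw [Submodule.mul_le] <;> rintro _ ⟨x, hx, rfl⟩ T hT
  · exact (h (m + 1) (n - m) (by omega) (by omega) x hx T hT).1
  · exact (h (m + 1) (n - m) (by omega) (by omega) x hx T hT).2

theorem mul_mem_operatorSpan {m n : ℕ} {T U : Module.End k A} (hT : T ∈ operatorSpan G m)
    (hU : U ∈ operatorSpan G n) : T * U ∈ operatorSpan G (m + n) := by
  induction m using Nat.strong_induction_on generalizing T with
  | _ m ih =>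
    match m with
    | 0 =>
      rw [operatorSpan, Submodule.mem_span_singleton] at hT
      obtain ⟨c, rfl⟩ := hT
      simpa using Submodule.smul_mem _ c hU
    | m + 1 =>
      suffices operatorSpan G (m + 1) ≤
          (operatorSpan G (m + 1 + n)).comap (LinearMap.mulRight k U) from this hT
      refine operatorSpan_le_of_mul_mem fun i j hi hij x hx S hS => ?_
      have hSU := ih j (by omega) hS
      rw [← hij, add_assoc]
      simp only [Submodule.mem_comap, LinearMap.mulRight_apply, mul_assoc]
      exact ⟨mulLeft_mul_mem_operatorSpan hi hx hSU, mulRight_mul_mem_operatorSpan hi hx hSU⟩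

theorem monomialSpan_le_lowerPower (n : ℕ) (hn : 0 < n) :
    monomialSpan G n ≤ lowerPower k A n := by
  induction n using Nat.strong_induction_on with
  | _ n ih =>
    match n with
    | 1 => rw [lowerPower_one]; exact le_top
    | n + 2 =>
      rw [monomialSpan]
      refine iSup_le fun m => Submodule.map₂_le.2 fun x hx y hy => ?_
      have := mul_mem_lowerPower (by omega) (by omega) (ih _ (by omega) (by omega) hx)
        (ih _ (by omega) (by omega) hy)
      rwa [show (m : ℕ) + 1 + (n + 1 - m) = n + 2 by omega] at this

theorem operatorSpan_apply_mem_lowerPower {n : ℕ} {T : Module.End k A} (hT : T ∈ operatorSpan G n)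
    (x : A) : T x ∈ lowerPower k A (n + 1) := by
  induction n using Nat.strong_induction_on generalizing T with
  | _ n ih =>
    match n with
    | 0 => rw [lowerPower_one]; trivial
    | n + 1 =>
      suffices operatorSpan G (n + 1) ≤
          (lowerPower k A (n + 1 + 1)).comap (LinearMap.applyₗ x) from this hT
      refine operatorSpan_le_of_mul_mem fun i j hi hij y hy S hS => ?_
      have h1 := ih j (by omega) hS
      have h2 := monomialSpan_le_lowerPower i hi hy
      rw [← hij]
      constructor
      · have := mul_mem_lowerPower hi (by omega) h2 h1
        rwa [← add_assoc] at this
      · have := mul_mem_lowerPower (by omega) hi h1 h2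
        rwa [show j + 1 + i = i + j + 1 by omega] at this

/-- Kernels are ideals. Consequently, composing with `T` preserves the continuous functionals. -/
theorem operatorSpan_ker_le {F : Type*} [NonUnitalNonAssocRing F] [Module k F] (π : A →ₙₐ[k] F)
    {n : ℕ} {T : Module.End k A} (hT : T ∈ operatorSpan G n) {x : A} (hx : π x = 0) :
    π (T x) = 0 := by
  induction n using Nat.strong_induction_on generalizing T with
  | _ n ih =>
    match n with
    | 0 =>
      rw [operatorSpan, Submodule.mem_span_singleton] at hT
      obtain ⟨c, rfl⟩ := hT
      simp [hx]
    | n + 1 =>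
      suffices operatorSpan G (n + 1) ≤
          (LinearMap.ker (π : A →ₗ[k] F)).comap (LinearMap.applyₗ x) from this hT
      refine operatorSpan_le_of_mul_mem fun i j hi hij y hy S hS => ?_
      have h1 := ih j (by omega) hS
      constructor
      · change π (y * S x) = 0
        rw [map_mul, h1, mul_zero]
      · change π (S x * y) = 0
        rw [map_mul, h1, zero_mul]

end Operators

/-! ### Extracting operators from long monomials -/

section Separation

variable {k : Type u} [Field k] {A : Type*} [NonUnitalNonAssocRing A] [Module k A]
  [IsScalarTower k A A] [SMulCommClass k A A] {X : Type*} (a : X → A)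

theorem lift_mem_monomialSpan (w : FreeMagma X) :
    FreeMagma.lift a w ∈ monomialSpan (Submodule.span k (Set.range a)) w.length := by
  induction w with
  | ih1 x =>
    change a x ∈ monomialSpan _ 1
    rw [monomialSpan]
    exact Submodule.subset_span ⟨x, rfl⟩
  | ih2 v w hv hw =>
    rw [map_mul]
    exact mul_mem_monomialSpan v.length_pos w.length_pos hv hw

/-- Going from `v` up to `w`, each sibling factor acts by a left or right multiplication; the
lengths of the siblings add up to `m`. -/
theorem IsSubmonomial.exists_operator {v w : FreeMagma X} (h : IsSubmonomial v w) :
    ∃ m, v.length + m = w.length ∧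
      ∃ T ∈ operatorSpan (Submodule.span k (Set.range a)) m,
        FreeMagma.lift a w = T (FreeMagma.lift a v) := by
  have base : (1 : Module.End k A) ∈ operatorSpan (Submodule.span k (Set.range a)) 0 := by
    rw [operatorSpan]
    exact Submodule.subset_span rfl
  induction w with
  | ih1 x =>
    obtain rfl : v = .of x := h
    exact ⟨0, rfl, 1, base, rfl⟩
  | ih2 b c hb hc =>
    rcases h with h | h | h
    · obtain rfl : v = b * c := h
      exact ⟨0, rfl, 1, base, rfl⟩
    · obtain ⟨m, hm, T, hT, e⟩ := hb h
      refine ⟨c.length + m, ?_, _,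
        mulRight_mul_mem_operatorSpan c.length_pos (lift_mem_monomialSpan a c) hT, ?_⟩
      · change _ = b.length + c.length
        omega
      · rw [map_mul, e]
        rfl
    · obtain ⟨m, hm, T, hT, e⟩ := hc h
      refine ⟨b.length + m, ?_, _,
        mulLeft_mul_mem_operatorSpan b.length_pos (lift_mem_monomialSpan a b) hT, ?_⟩
      · change _ = b.length + c.length
        omega
      · rw [map_mul, e]
        rfl

/-- The span of the elements `T v` where `v` is a monomial and `T` an operator of length in
`[m, M]`, of total length `n`. -/
def separatedSpan (k : Type u) [Field k] {A : Type*} [NonUnitalNonAssocRing A] [Module k A]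
    [IsScalarTower k A A] [SMulCommClass k A A] {X : Type*} (a : X → A) (m M n : ℕ) :
    Submodule k A :=
  Submodule.span k {y | ∃ (l : ℕ) (v : FreeMagma X), m ≤ l ∧ l ≤ M ∧ v.length + l = n ∧
    ∃ T ∈ operatorSpan (Submodule.span k (Set.range a)) l, y = T (FreeMagma.lift a v)}

variable {a} in
theorem IsIntervalSeparating.lift_mem {m M : ℕ} {w : FreeMagma X}
    (h : IsIntervalSeparating m M w) :
    FreeMagma.lift a w ∈ separatedSpan k a m M w.length := by
  obtain ⟨l, h1, h2, v, hv, hl⟩ := h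
  obtain ⟨l', hl', T, hT, e⟩ := hv.exists_operator (k := k) a
  obtain rfl : l = l' := by omega
  exact Submodule.subset_span ⟨l, v, h1, h2, hl, T, hT, e⟩

theorem Variety.IsIntervalSeparative.lift_mem {V : Variety k} {d : ℕ}
    (hV : V.IsIntervalSeparative d) (hA : V.Mem A) (a : ℕ → A) (w : FreeMagma ℕ)
    (hw : 1 < w.length) : FreeMagma.lift a w ∈ separatedSpan k a 1 (1 + d) w.length := by
  -- If `w` occurred in `p`, it could cancel in `w - p`, and homogeneity would no longer tie the
  -- other monomials to the length of `w`. A separating `w` needs no identity.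
  by_cases hsep : IsIntervalSeparating 1 (1 + d) w
  · exact hsep.lift_mem
  obtain ⟨p, hp, hhom, hid⟩ := hV w hw
  have hwp : w ∉ p.coeff.support := fun h => hsep (hp w h)
  have key := hid.satisfiesIdentity hA a
  rw [map_sub, sub_eq_zero, lift_apply_eq_sum, lift_apply_eq_sum, MonoidAlgebra.coeff_single,
    Finsupp.sum_single_index (by simp), one_smul] at key
  rw [key]
  refine Submodule.sum_mem _ fun v hv => Submodule.smul_mem _ _ ?_
  have hne : v ≠ w := fun h => hwp (h ▸ hv)
  have hlen : v.length = w.length := by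
    refine hhom.length_eq ?_ ?_
    · have := Finsupp.mem_support_iff.1 hv
      simpa [Finsupp.single_apply, hne.symm] using this
    · have := Finsupp.notMem_support_iff.1 hwp
      simp [this]
  rw [← hlen]
  exact (hp v hv).lift_mem

theorem Variety.IsIntervalSeparative.lift_mem_of_lt {V : Variety k} {d : ℕ}
    (hV : V.IsIntervalSeparative d) (hA : V.Mem A) (a : ℕ → A) (j : ℕ) (w : FreeMagma ℕ)
    (hw : j < w.length) : FreeMagma.lift a w ∈ separatedSpan k a j (j + d) w.length := by
  induction j with
  | zero =>
    refine Submodule.subset_span ⟨0, w, le_rfl, by omega, rfl, 1, ?_, rfl⟩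
    rw [operatorSpan]
    exact Submodule.subset_span rfl
  | succ j ih =>
    refine Submodule.span_le.2 ?_ (ih (by omega))
    rintro _ ⟨l, v, h1, h2, h3, T, hT, rfl⟩
    -- Only operators of length exactly `j` leave the new window. For these, separating `v` once
    -- more adds between `1` and `1 + d` to the length.
    rcases Nat.lt_or_ge j l with h | h
    · exact Submodule.subset_span ⟨l, v, h, by omega, h3, T, hT, rfl⟩
    · suffices separatedSpan k a 1 (1 + d) v.length ≤
          (separatedSpan k a (j + 1) (j + 1 + d) w.length).comap T from
        this (hV.lift_mem hA a v (by omega))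
      refine Submodule.span_le.2 ?_
      rintro _ ⟨l', v', h1', h2', h3', U, hU, rfl⟩
      exact Submodule.subset_span ⟨l + l', v', by omega, by omega, by omega, T * U,
        mul_mem_operatorSpan hT hU, rfl⟩

end Separation

/-! ### Duality and linear compactness of inverse limits -/

theorem exists_extend_of_ker_le {K V W : Type*} [Field K] [AddCommGroup V] [Module K V]
    [AddCommGroup W] [Module K W] (g : V →ₗ[K] W) (e : Module.Dual K V)
    (h : ∀ v, g v = 0 → e v = 0) : ∃ L : Module.Dual K W, ∀ v, L (g v) = e v := by
  have : e ∈ LinearMap.range g.dualMap := by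
    rw [LinearMap.range_dualMap_eq_dualAnnihilator_ker, Submodule.mem_dualAnnihilator]
    exact h
  obtain ⟨L, hL⟩ := this
  exact ⟨L, LinearMap.congr_fun hL⟩

section InverseLimits

variable {k : Type u} [Field k] {I : Type*} {F : I → Type*}
  [∀ i, NonUnitalNonAssocRing (F i)] [∀ i, Module k (F i)]
  {A : Type*} [NonUnitalNonAssocRing A] [Module k A]

theorem isOpen_of_saturated (π : ∀ i, A →ₙₐ[k] F i) (i : I) {U : Set A}
    (h : ∀ x ∈ U, ∀ y, π i x = π i y → y ∈ U) : IsOpen[inverseLimitTopology π] U := by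
  refine iInf_le (fun i => TopologicalSpace.induced (π i) ⊥) i U ?_
  refine (@isOpen_induced_iff _ _ ⊥ _ _).2 ⟨π i '' U, trivial, ?_⟩
  ext y
  exact ⟨fun ⟨x, hx, e⟩ => h x hx y e, fun hy => ⟨y, hy, rfl⟩⟩

theorem isOpen_of_ker_le (π : ∀ i, A →ₙₐ[k] F i) (i : I) {W : Submodule k A}
    (h : ∀ x, π i x = 0 → x ∈ W) : IsOpen[inverseLimitTopology π] (W : Set A) := by
  refine isOpen_of_saturated π i fun x hx y e => ?_
  have := W.sub_mem hx (h (x - y) (by rw [map_sub, e, sub_self]))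
  rwa [sub_sub_cancel] at this

theorem continuous_of_ker_le {B : Type*} [NonUnitalNonAssocRing B] [Module k B]
    (π : ∀ i, A →ₙₐ[k] F i) (i : I) (f : A →ₙₐ[k] B) (h : ∀ x, π i x = 0 → f x = 0) :
    Continuous[inverseLimitTopology π, ⊥] f := by
  refine @Continuous.mk _ _ (inverseLimitTopology π) ⊥ _ fun U _ => ?_
  refine isOpen_of_saturated π i fun x hx y e => ?_
  have := h (x - y) (by rw [map_sub, e, sub_self])
  rw [map_sub, sub_eq_zero] at this
  exact Set.mem_preimage.2 (this ▸ hx)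

theorem exists_mem_apply_eq_of_dense (π : ∀ i, A →ₙₐ[k] F i) {S : Set A}
    (hS : @Dense A (inverseLimitTopology π) S) (i : I) (x : A) : ∃ y ∈ S, π i y = π i x := by
  have ho : IsOpen[inverseLimitTopology π] {y | π i y = π i x} :=
    isOpen_of_saturated π i fun y hy z e => e.symm.trans hy
  exact (@Dense.exists_mem_open A (inverseLimitTopology π) S hS _ ho ⟨x, rfl⟩)

/-- The linear functionals on `A` that factor through one of the projections. -/
def continuousDual (π : ∀ i, A →ₙₐ[k] F i) : Submodule k (Module.Dual k A) :=
  ⨆ i, (LinearMap.ker (π i : A →ₗ[k] F i)).dualAnnihilator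

variable {π : ∀ i, A →ₙₐ[k] F i}

theorem mem_continuousDual_of_comp (i : I) (l : Module.Dual k (F i)) :
    l ∘ₗ (π i : A →ₗ[k] F i) ∈ continuousDual π := by
  refine Submodule.mem_iSup_of_mem i ((Submodule.mem_dualAnnihilator _).2 fun x hx => ?_)
  rw [LinearMap.comp_apply, LinearMap.mem_ker.1 hx, map_zero]

variable [Preorder I] {φ : ∀ ⦃i j : I⦄, i ≤ j → (F j →ₙₐ[k] F i)}

namespace IsInverseLimit

theorem apply_eq_zero (hlim : IsInverseLimit φ π) {i j : I} (h : i ≤ j) {x : A}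
    (hx : π j x = 0) : π i x = 0 := by
  rw [← hlim.compatible h, hx, map_zero]

theorem ext (hlim : IsInverseLimit φ π) {x y : A} (h : ∀ i, π i x = π i y) : x = y := by
  obtain ⟨z, -, hz⟩ := hlim.existsUnique (fun i => π i y) fun i j hij => hlim.compatible hij y
  rw [hz x h, hz y fun _ => rfl]

theorem eq_of_continuousDual (hlim : IsInverseLimit φ π) {x y : A}
    (h : ∀ l ∈ continuousDual π, l x = l y) : x = y := by
  refine hlim.ext fun i => ?_
  rw [← sub_eq_zero, ← Module.forall_dual_apply_eq_zero_iff k]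
  intro l
  rw [map_sub, sub_eq_zero]
  exact h _ (mem_continuousDual_of_comp i l)

theorem directed_dualAnnihilator [IsDirectedOrder I] (hlim : IsInverseLimit φ π) :
    Directed (· ≤ ·) fun i => (LinearMap.ker (π i : A →ₗ[k] F i)).dualAnnihilator := by
  refine Monotone.directed_le fun i j hij => Submodule.dualAnnihilator_anti fun x hx => ?_
  exact hlim.apply_eq_zero hij hx

variable [IsDirectedOrder I] [Nonempty I]

theorem mem_continuousDual (hlim : IsInverseLimit φ π) {l : Module.Dual k A} :
    l ∈ continuousDual π ↔ ∃ i, ∀ x, π i x = 0 → l x = 0 := by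
  rw [continuousDual, Submodule.mem_iSup_of_directed _ hlim.directed_dualAnnihilator]
  simp only [Submodule.mem_dualAnnihilator]
  rfl

/-- Every functional on the continuous dual is the evaluation at a point. -/
theorem exists_eval (hlim : IsInverseLimit φ π) (hfin : ∀ i, Module.Finite k (F i))
    (L : continuousDual π →ₗ[k] k) : ∃ x : A, ∀ l : continuousDual π, l.1 x = L l := by
  let c : ∀ i, Module.Dual k (F i) →ₗ[k] continuousDual π := fun i =>
    LinearMap.codRestrict _ (π i : A →ₗ[k] F i).dualMap (mem_continuousDual_of_comp i)
  -- Each `F i` is its own double dual, so `L` restricted to functionals through `π i` is evaluation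
  -- at a point. These points are compatible.
  let x : ∀ i, F i := fun i => (Module.evalEquiv k (F i)).symm (L ∘ₗ c i)
  have hx : ∀ i (l : Module.Dual k (F i)), l (x i) = L (c i l) := fun i l =>
    Module.apply_evalEquiv_symm_apply k (F i) l (L ∘ₗ c i)
  obtain ⟨y, hy, -⟩ := hlim.existsUnique x fun i j hij => by
    rw [← sub_eq_zero, ← Module.forall_dual_apply_eq_zero_iff k]
    intro l
    rw [map_sub, sub_eq_zero, hx]
    have := hx j (l ∘ₗ (φ hij : F j →ₗ[k] F i))
    refine this.trans (congrArg L (Subtype.ext (LinearMap.ext fun a => ?_)))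
    exact congrArg l (hlim.compatible hij a)
  refine ⟨y, fun l => ?_⟩
  obtain ⟨i, hi⟩ := hlim.mem_continuousDual.1 l.2
  obtain ⟨m, hm⟩ := exists_extend_of_ker_le (π i : A →ₗ[k] F i) l.1 hi
  have hl : l = c i m := Subtype.ext (LinearMap.ext hm).symm
  rw [hl, ← hx, ← hy]
  rfl

/-- A finite sum of images of `A` under operators that preserve the kernels of the projections is
closed: it contains all points annihilated by its annihilator in the continuous dual. -/
theorem exists_eq_sum (hlim : IsInverseLimit φ π) (hfin : ∀ i, Module.Finite k (F i))
    {ι : Type*} [Fintype ι] (T : ι → Module.End k A)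
    (hT : ∀ j i x, π i x = 0 → π i (T j x) = 0) {y : A}
    (hy : ∀ l ∈ continuousDual π, (∀ j x, l (T j x) = 0) → l y = 0) :
    ∃ x : ι → A, y = ∑ j, T j (x j) := by
  classical
  have hmem : ∀ j, ∀ l : continuousDual π, l.1 ∘ₗ T j ∈ continuousDual π := fun j l => by
    obtain ⟨i, hi⟩ := hlim.mem_continuousDual.1 l.2
    exact hlim.mem_continuousDual.2 ⟨i, fun x hx => hi _ (hT j i x hx)⟩
  -- The kernel of `g` is the annihilator of `∑ T j A`, on which evaluation at `y` vanishes. So that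
  -- evaluation factors through `g`, and the components of the factor are evaluations at the points
  -- `x j`.
  let g : continuousDual π →ₗ[k] (ι → continuousDual π) := LinearMap.pi fun j =>
    LinearMap.codRestrict _ ((T j).dualMap ∘ₗ (continuousDual π).subtype) (hmem j)
  let e : continuousDual π →ₗ[k] k := Module.Dual.eval k A y ∘ₗ (continuousDual π).subtype
  have he : ∀ l, g l = 0 → e l = 0 := fun l hl => hy l.1 l.2 fun j x =>
    LinearMap.congr_fun (congrArg Subtype.val (congrFun hl j)) x
  obtain ⟨L, hL⟩ := exists_extend_of_ker_le (V := continuousDual π)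
    (W := ι → continuousDual π) g e he
  choose x hx using fun j =>
    hlim.exists_eval hfin (L ∘ₗ LinearMap.single k (fun _ : ι => continuousDual π) j)
  refine ⟨x, hlim.eq_of_continuousDual fun l hl => ?_⟩
  have h1 : l y = L (g ⟨l, hl⟩) := (hL ⟨l, hl⟩).symm
  rw [h1, ← Finset.univ_sum_single (g ⟨l, hl⟩), map_sum, map_sum]
  exact Finset.sum_congr rfl fun j _ => (hx j _).symm

/-- A closed subspace of finite codimension is open. -/
theorem exists_ker_le (hlim : IsInverseLimit φ π) {W P : Submodule k A} (hP : P.FG)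
    (hclosed : ∀ y, (∀ l ∈ continuousDual π, (∀ x ∈ W, l x = 0) → l y = 0) → y ∈ W)
    (hcodim : ∀ l ∈ continuousDual π, (∀ x ∈ W, l x = 0) → (∀ x ∈ P, l x = 0) → l = 0) :
    ∃ i, ∀ x, π i x = 0 → x ∈ W := by
  classical
  let E : Submodule k (Module.Dual k A) := continuousDual π ⊓ W.dualAnnihilator
  have : Module.Finite k P := Module.Finite.iff_fg.2 hP
  have hE : E.FG := by
    rw [← Module.Finite.iff_fg]
    -- By `hcodim`, a functional in `E` is determined by its restriction to the finite-dimensional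
    -- `P`.
    refine Module.Finite.of_injective (P.subtype.dualMap ∘ₗ E.subtype) ?_
    refine (injective_iff_map_eq_zero _).2 fun l hl => ?_
    refine Subtype.ext (hcodim l.1 l.2.1 ((Submodule.mem_dualAnnihilator _).1 l.2.2) fun x hx => ?_)
    exact LinearMap.congr_fun hl ⟨x, hx⟩
  -- Finitely many generators of `E` factor through a common projection, by directedness.
  obtain ⟨i, hi⟩ : ∃ i, E ≤ (LinearMap.ker (π i : A →ₗ[k] F i)).dualAnnihilator := by
    obtain ⟨s, hs⟩ := hE
    have hsub : ∀ l ∈ s, l ∈ E := fun l hl => hs ▸ Submodule.subset_span hl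
    choose! i hi using fun l (hl : l ∈ s) => hlim.mem_continuousDual.1 (hsub l hl).1
    obtain ⟨j, hj⟩ := (s.image i).exists_le
    refine ⟨j, ?_⟩
    rw [← hs, Submodule.span_le]
    intro l hl
    refine (Submodule.mem_dualAnnihilator _).2 fun x hx => hi l hl x ?_
    exact hlim.apply_eq_zero (hj _ (Finset.mem_image_of_mem i hl)) hx
  refine ⟨i, fun x hx => hclosed x fun l hl hW => ?_⟩
  exact (Submodule.mem_dualAnnihilator _).1
    (hi ⟨hl, (Submodule.mem_dualAnnihilator _).2 hW⟩) x hx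

end IsInverseLimit

end InverseLimits

/-! ### Density of long monomials in `A_(n)` -/

section MonomialTails

variable (k : Type u) [Field k] {A : Type*} [NonUnitalNonAssocRing A] [Module k A]
  [IsScalarTower k A A] [SMulCommClass k A A] {X : Type*} (a : X → A)

/-- The span of the values of all monomials of length at least `n`. -/
def monomialTail (n : ℕ) : Submodule k A :=
  Submodule.span k {y | ∃ w : FreeMagma X, n ≤ w.length ∧ y = FreeMagma.lift a w}

variable {k a}

theorem mul_mem_monomialTail {m n : ℕ} {x y : A} (hx : x ∈ monomialTail k a m)
    (hy : y ∈ monomialTail k a n) : x * y ∈ monomialTail k a (m + n) := by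
  refine (Submodule.map₂_span_span k (LinearMap.mul k A) _ _).trans_le (Submodule.span_mono ?_)
    (Submodule.apply_mem_map₂ _ hx hy)
  rintro _ ⟨_, ⟨v, hv, rfl⟩, _, ⟨w, hw, rfl⟩, rfl⟩
  exact ⟨v * w, Nat.add_le_add hv hw, (map_mul (FreeMagma.lift a) v w).symm⟩

theorem adjoin_subset_monomialTail {s : Set A} (hs : s ⊆ Set.range a) :
    (NonUnitalAlgebra.adjoin k s : Set A) ⊆ monomialTail k a 1 := by
  intro x hx
  induction hx using NonUnitalAlgebra.adjoin_induction with
  | mem x hx =>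
    obtain ⟨n, rfl⟩ := hs hx
    exact Submodule.subset_span ⟨.of n, le_rfl, rfl⟩
  | zero => exact Submodule.zero_mem _
  | add x y _ _ hx hy => exact Submodule.add_mem _ hx hy
  | smul c x _ hx => exact Submodule.smul_mem _ c hx
  | mul x y _ _ hx hy =>
    refine Submodule.span_mono ?_ (mul_mem_monomialTail hx hy)
    rintro _ ⟨w, hw, rfl⟩
    exact ⟨w, by omega, rfl⟩

/-- Factors of a product can be approximated separately, since `π` is multiplicative. -/
theorem exists_mem_monomialTail {F : Type*} [NonUnitalNonAssocRing F] [Module k F]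
    (π : A →ₙₐ[k] F) (h : ∀ x, ∃ y ∈ monomialTail k a 1, π y = π x) (n : ℕ) (hn : 0 < n) :
    ∀ x ∈ lowerPower k A n, ∃ y ∈ monomialTail k a n, π y = π x := by
  induction n using Nat.strong_induction_on with
  | _ n ih =>
    match n with
    | 1 => exact fun x _ => h x
    | n + 2 =>
      suffices lowerPower k A (n + 2) ≤
          ((monomialTail k a (n + 2)).map (π : A →ₗ[k] F)).comap (π : A →ₗ[k] F) from
        fun x hx => this hx
      refine lowerPower_le_of_mul_mem (by omega) fun i j hi hj hij x hx y hy => ?_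
      obtain ⟨x', hx', ex⟩ := ih i (by omega) hi x hx
      obtain ⟨y', hy', ey⟩ := ih j (by omega) hj y hy
      refine ⟨x' * y', hij ▸ mul_mem_monomialTail hx' hy', ?_⟩
      change π (x' * y') = π (x * y)
      rw [map_mul, map_mul, ex, ey]

end MonomialTails

/-! ### Openness of `A_(n)` -/

section OpenPowers

variable {k : Type u} [Field k] {I : Type*} [Preorder I] [IsDirectedOrder I] [Nonempty I]
  {F : I → Type*} [∀ i, NonUnitalNonAssocRing (F i)] [∀ i, Module k (F i)]
  {φ : ∀ ⦃i j : I⦄, i ≤ j → (F j →ₙₐ[k] F i)}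
  {A : Type*} [NonUnitalNonAssocRing A] [Module k A] [IsScalarTower k A A] [SMulCommClass k A A]
  {π : ∀ i, A →ₙₐ[k] F i}

theorem exists_ker_le_lowerPower {V : Variety k} (hV : V.IsSeparative)
    (hlim : IsInverseLimit φ π) (hfin : ∀ i, Module.Finite k (F i)) (hA : V.Mem A)
    (hdense : ∃ s : Finset A,
      @Dense A (inverseLimitTopology π) (NonUnitalAlgebra.adjoin k (s : Set A) : Set A))
    (n : ℕ) (hn : 0 < n) : ∃ i, ∀ x, π i x = 0 → x ∈ lowerPower k A n := by
  obtain ⟨d, hV⟩ := hV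
  obtain ⟨s, hs⟩ := hdense
  -- Identities use indeterminates indexed by `ℕ`, so the finite list of generators is padded with
  -- `0`.
  obtain ⟨a, hsa, hfa⟩ : ∃ a : ℕ → A, (s : Set A) ⊆ Set.range a ∧ (Set.range a).Finite := by
    refine ⟨fun n => s.toList.getD n 0, fun x hx => ?_, ?_⟩
    · obtain ⟨n, hn, e⟩ := List.getElem_of_mem (Finset.mem_toList.2 hx)
      exact ⟨n, (List.getD_eq_getElem _ _ hn).trans e⟩
    · refine (s.finite_toSet.insert 0).subset ?_
      rintro _ ⟨n, rfl⟩
      rcases Nat.lt_or_ge n s.toList.length with h | h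
      · right
        simp only [List.getD_eq_getElem _ _ h]
        exact Finset.mem_toList.1 (List.getElem_mem h)
      · left
        simp only [List.getD_eq_default _ _ h]
  let G := Submodule.span k (Set.range a)
  have hG : G.FG := Submodule.fg_span hfa
  have hmono : ∀ i x, ∃ y ∈ monomialTail k a 1, π i y = π i x := fun i x => by
    obtain ⟨y, hy, e⟩ := exists_mem_apply_eq_of_dense π hs i x
    exact ⟨y, adjoin_subset_monomialTail hsa hy, e⟩
  have hkill : ∀ l ∈ continuousDual π, ∀ m, 0 < m → (∀ x ∈ monomialTail k a m, l x = 0) →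
      ∀ x ∈ lowerPower k A m, l x = 0 := fun l hl m hm h x hx => by
    obtain ⟨i, hi⟩ := hlim.mem_continuousDual.1 hl
    obtain ⟨y, hy, e⟩ := exists_mem_monomialTail (π i) (hmono i) m hm x hx
    rw [← sub_add_cancel x y, map_add, h y hy, hi _ (by rw [map_sub, e, sub_self]), add_zero]
  -- Length `n - 1` is enough to map `A` into `A_(n)`, and is still less than the length of every
  -- monomial in the `n`-th tail.
  let O : Submodule k (Module.End k A) := ⨆ m : Fin (d + 1), operatorSpan G (n - 1 + m)
  obtain ⟨N, T, hT⟩ := Submodule.fg_iff_exists_fin_generating_family.1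
    (show O.FG from Submodule.fg_iSup _ fun m => operatorSpan_fg hG _)
  have hTO : ∀ j, T j ∈ O := fun j => hT ▸ Submodule.subset_span ⟨j, rfl⟩
  have hpow : ∀ j x, T j x ∈ lowerPower k A n := fun j x => by
    suffices O ≤ (lowerPower k A n).comap (LinearMap.applyₗ x) from this (hTO j)
    refine iSup_le fun m U hU => ?_
    exact lowerPower_antitone (by omega) (operatorSpan_apply_mem_lowerPower hU x)
  refine hlim.exists_ker_le (P := ⨆ m : Fin n, monomialSpan G m)
    (Submodule.fg_iSup _ fun m => monomialSpan_fg hG _) (fun y hy => ?_) fun l hl hW hP => ?_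
  -- Closedness: a continuous functional killing every `T j A` kills all long monomials by
  -- separation, hence `A_(n)` by density, hence `y`.
  · obtain ⟨x, rfl⟩ := hlim.exists_eq_sum hfin T (fun j i x hx => by
      suffices O ≤ (LinearMap.ker (π i : A →ₗ[k] F i)).comap (LinearMap.applyₗ x) from
        this (hTO j)
      exact iSup_le fun m U hU => operatorSpan_ker_le (π i) hU hx) (y := y) fun l hl h => by
        refine hy l hl (hkill l hl n hn ?_)
        have hO : ∀ U ∈ O, ∀ x, l (U x) = 0 := fun U hU x => by
          suffices O ≤ (LinearMap.ker l).comap (LinearMap.applyₗ x) from this hU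
          rw [← hT, Submodule.span_le]
          rintro _ ⟨j, rfl⟩
          exact h j x
        suffices monomialTail k a n ≤ LinearMap.ker l from fun x hx => this hx
        refine Submodule.span_le.2 ?_
        rintro _ ⟨w, hw, rfl⟩
        suffices separatedSpan k a (n - 1) (n - 1 + d) w.length ≤ LinearMap.ker l from
          this (hV.lift_mem_of_lt hA a (n - 1) w (by omega))
        refine Submodule.span_le.2 ?_
        rintro _ ⟨m, v, h1, h2, -, U, hU, rfl⟩
        refine hO U (Submodule.mem_iSup_of_mem ⟨m - (n - 1), by omega⟩ ?_) _
        rwa [show n - 1 + (m - (n - 1)) = m by omega]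
    exact Submodule.sum_mem _ fun j _ => hpow j _
  -- Finite codimension: monomials of length less than `n` lie in `P`, the others in `A_(n)`, and
  -- all monomials together span a dense subspace.
  · refine LinearMap.ext fun x => hkill l hl 1 one_pos ?_ x (by rw [lowerPower_one]; trivial)
    suffices monomialTail k a 1 ≤ LinearMap.ker l from fun x hx => this hx
    refine Submodule.span_le.2 ?_
    rintro _ ⟨w, -, rfl⟩
    have hw := lift_mem_monomialSpan (k := k) a w
    rcases Nat.lt_or_ge w.length n with h | h
    · exact hP _ (Submodule.mem_iSup_of_mem ⟨w.length, h⟩ hw)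
    · exact hW _ (lowerPower_antitone h (monomialSpan_le_lowerPower _ w.length_pos hw))

theorem exists_ker_le_ker_of_isNilpotentAlg {V : Variety k} (hV : V.IsSeparative)
    (hlim : IsInverseLimit φ π) (hfin : ∀ i, Module.Finite k (F i)) (hA : V.Mem A)
    (hdense : ∃ s : Finset A,
      @Dense A (inverseLimitTopology π) (NonUnitalAlgebra.adjoin k (s : Set A) : Set A))
    {B : Type*} [NonUnitalNonAssocRing B] [Module k B] [IsScalarTower k B B]
    [SMulCommClass k B B] (hB : IsNilpotentAlg k B) (f : A →ₙₐ[k] B) :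
    ∃ i, ∀ x, π i x = 0 → f x = 0 := by
  obtain ⟨n, hn, hB⟩ := hB
  obtain ⟨i, hi⟩ := exists_ker_le_lowerPower hV hlim hfin hA hdense n hn
  refine ⟨i, fun x hx => ?_⟩
  have := map_mem_lowerPower f n x (hi x hx)
  rwa [hB, Submodule.mem_bot] at this

end OpenPowers

/-! ### Linear systems over nilpotent algebras and their limits -/

section LinearSystems

variable {k : Type u} [Field k] {A : Type*} [NonUnitalNonAssocRing A] [Module k A]
  [IsScalarTower k A A] [SMulCommClass k A A] {ι : Type*} [Fintype ι]

/-- The operator `x ↦ (∑ l, (b j l * x l + x l * c j l))_j` on families. -/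
def mulSystem (k : Type u) [Field k] {A : Type*} [NonUnitalNonAssocRing A] [Module k A]
    [IsScalarTower k A A] [SMulCommClass k A A] {ι : Type*} [Fintype ι] (b c : ι → ι → A) :
    (ι → A) →ₗ[k] (ι → A) :=
  LinearMap.pi fun j => ∑ l,
    (LinearMap.mul k A (b j l) + (LinearMap.mul k A).flip (c j l)) ∘ₗ LinearMap.proj l

theorem mulSystem_apply (b c : ι → ι → A) (x : ι → A) (j : ι) :
    mulSystem k b c x j = ∑ l, (b j l * x l + x l * c j l) := by
  simp [mulSystem]

theorem map_mulSystem {B : Type*} [NonUnitalNonAssocRing B] [Module k B]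
    [IsScalarTower k B B] [SMulCommClass k B B] (f : A →ₙₐ[k] B) (b c : ι → ι → A) (x : ι → A)
    (j : ι) : f (mulSystem k b c x j) =
      mulSystem k (fun j l => f (b j l)) (fun j l => f (c j l)) (fun l => f (x l)) j := by
  simp [mulSystem_apply]

/-- Each substitution of `x` into the right side of the equation moves its entries one power `A_(n)`
deeper. -/
theorem IsNilpotentAlg.eq_zero_of_mulSystem_eq (hA : IsNilpotentAlg k A) {b c : ι → ι → A}
    {x : ι → A} (hx : mulSystem k b c x = x) : x = 0 := by
  have key : ∀ n, ∀ j, x j ∈ lowerPower k A (n + 1) := by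
    intro n
    induction n with
    | zero => intro j; rw [lowerPower_one]; trivial
    | succ n ih =>
      intro j
      rw [← hx, mulSystem_apply]
      refine Submodule.sum_mem _ fun l _ => Submodule.add_mem _ ?_ ?_
      · have := mul_mem_lowerPower one_pos n.succ_pos
          (show b j l ∈ lowerPower k A 1 by rw [lowerPower_one]; trivial) (ih l)
        rwa [add_comm] at this
      · exact mul_mem_lowerPower n.succ_pos one_pos (ih l)
          (show c j l ∈ lowerPower k A 1 by rw [lowerPower_one]; trivial)
  obtain ⟨n, hn, h⟩ := hA
  obtain ⟨n, rfl⟩ := Nat.exists_eq_add_of_le' hn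
  funext j
  have := key n j
  rwa [h, Submodule.mem_bot] at this

theorem IsNilpotentAlg.injective_sub_mulSystem (hA : IsNilpotentAlg k A) (b c : ι → ι → A) :
    Function.Injective (LinearMap.id - mulSystem k b c : (ι → A) →ₗ[k] (ι → A)) := by
  rw [← LinearMap.ker_eq_bot, LinearMap.ker_eq_bot']
  intro x hx
  exact hA.eq_zero_of_mulSystem_eq (sub_eq_zero.1 hx).symm

/-- Over each `F i`, injectivity gives bijectivity by finite dimension; uniqueness makes the
solutions compatible, so they define a solution in the limit. -/
theorem IsInverseLimit.surjective_sub_mulSystem {I : Type*} [Preorder I] {F : I → Type*}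
    [∀ i, NonUnitalNonAssocRing (F i)] [∀ i, Module k (F i)]
    [∀ i, IsScalarTower k (F i) (F i)] [∀ i, SMulCommClass k (F i) (F i)]
    {φ : ∀ ⦃i j : I⦄, i ≤ j → (F j →ₙₐ[k] F i)} {π : ∀ i, A →ₙₐ[k] F i}
    (hlim : IsInverseLimit φ π) (hfin : ∀ i, Module.Finite k (F i))
    (hnil : ∀ i, IsNilpotentAlg k (F i)) (b c : ι → ι → A) :
    Function.Surjective (LinearMap.id - mulSystem k b c : (ι → A) →ₗ[k] (ι → A)) := by
  intro y
  have hinj := fun i => (hnil i).injective_sub_mulSystem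
    (fun j l => π i (b j l)) (fun j l => π i (c j l))
  have hex := fun i => LinearMap.injective_iff_surjective.1 (hinj i) (fun j => π i (y j))
  choose x hx using hex
  have hcomp : ∀ ⦃i i' : I⦄ (h : i ≤ i') j, φ h (x i' j) = x i j := fun i i' h => by
    refine congrFun (hinj i ((?_ : _ = _).trans (hx i).symm) :
      (fun j => φ h (x i' j)) = x i)
    funext j
    have h1 := congrArg (φ h) (congrFun (hx i') j)
    simp only [LinearMap.sub_apply, LinearMap.id_apply, Pi.sub_apply, map_sub, map_mulSystem,
      hlim.compatible] at h1 ⊢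
    exact h1
  choose z hz _ using fun j => hlim.existsUnique (fun i => x i j) fun i i' h => hcomp h j
  refine ⟨z, funext fun j => hlim.ext fun i => ?_⟩
  have h1 := congrFun (hx i) j
  simp only [LinearMap.sub_apply, LinearMap.id_apply, Pi.sub_apply, map_sub, map_mulSystem,
    hz] at h1 ⊢
  exact h1

end LinearSystems

/-! ### Nilpotence of finite-dimensional images -/

section NilpotentImages

variable {k : Type u} [Field k] {B : Type*} [NonUnitalNonAssocRing B] [Module k B]
  [IsScalarTower k B B] [SMulCommClass k B B]

/-- The subspace `B C + C B`. -/
def mulBoth (C : Submodule k B) : Submodule k B :=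
  Submodule.map₂ (LinearMap.mul k B) ⊤ C ⊔ Submodule.map₂ (LinearMap.mul k B) C ⊤

theorem mulBoth_mono : Monotone (mulBoth : Submodule k B → Submodule k B) := fun _ _ h =>
  sup_le_sup (Submodule.map₂_le_map₂_right h) (Submodule.map₂_le_map₂_left h)

/-- In a product of total degree `2 ^ (n + 1)`, one factor has degree at least `2 ^ n`. -/
theorem lowerPower_two_pow_le (n : ℕ) : lowerPower k B (2 ^ n) ≤ mulBoth^[n] ⊤ := by
  induction n with
  | zero => exact le_top
  | succ n ih =>
    rw [Function.iterate_succ_apply']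
    have h2 : 0 < 2 ^ n := by positivity
    refine lowerPower_le_of_mul_mem (by rw [pow_succ]; omega) fun i j hi hj hij x hx y hy => ?_
    rw [pow_succ] at hij
    rcases Nat.lt_or_ge i (2 ^ n) with h | h
    · exact Submodule.mem_sup_left (Submodule.apply_mem_map₂ _ trivial
        (ih (lowerPower_antitone (by omega) hy)))
    · exact Submodule.mem_sup_right (Submodule.apply_mem_map₂ _
        (ih (lowerPower_antitone h hx)) trivial)

/-- The descending iterates of `mulBoth` stabilize at a fixed point, which is zero by hypothesis and
contains some `B_(2 ^ n)`. -/
theorem isNilpotentAlg_of_forall_mulBoth [Module.Finite k B]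
    (h : ∀ C : Submodule k B, mulBoth C = C → C = ⊥) : IsNilpotentAlg k B := by
  have hanti : Antitone fun n => mulBoth^[n] (⊤ : Submodule k B) :=
    mulBoth_mono.antitone_iterate_of_map_le le_top
  obtain ⟨n, hn⟩ := IsArtinian.monotone_stabilizes
    (⟨fun n => OrderDual.toDual (mulBoth^[n] (⊤ : Submodule k B)), fun _ _ h => hanti h⟩ :
      ℕ →o (Submodule k B)ᵒᵈ)
  have hn : mulBoth^[n] (⊤ : Submodule k B) = mulBoth^[n + 1] ⊤ := hn (n + 1) n.le_succ
  refine ⟨2 ^ n, Nat.one_le_two_pow, le_bot_iff.1 ((lowerPower_two_pow_le n).trans ?_)⟩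
  rw [Function.iterate_succ_apply'] at hn
  exact (h _ hn.symm).le

theorem exists_eq_sum_of_mem_mulBoth {ι : Type*} [Fintype ι] (c : ι → B) {x : B}
    (hx : x ∈ mulBoth (Submodule.span k (Set.range c))) :
    ∃ b b' : ι → B, x = ∑ l, (b l * c l + c l * b' l) := by
  let g : (ι → B) × (ι → B) →ₗ[k] B := ∑ l,
    ((LinearMap.mul k B).flip (c l) ∘ₗ LinearMap.proj l ∘ₗ LinearMap.fst k _ _ +
      LinearMap.mul k B (c l) ∘ₗ LinearMap.proj l ∘ₗ LinearMap.snd k _ _)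
  have hg : ∀ b b', g (b, b') = ∑ l, (b l * c l + c l * b' l) := fun b b' => by simp [g]
  suffices mulBoth (Submodule.span k (Set.range c)) ≤ LinearMap.range g by
    obtain ⟨⟨b, b'⟩, e⟩ := this hx
    exact ⟨b, b', by rw [← hg, e]⟩
  refine sup_le (Submodule.map₂_le.2 fun y _ z hz => ?_) (Submodule.map₂_le.2 fun z hz y _ => ?_)
  all_goals
    obtain ⟨t, rfl⟩ := (Submodule.mem_span_range_iff_exists_fun k).1 hz
  · exact ⟨(fun l => t l • y, 0), by simp [hg, smul_mul_assoc]⟩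
  · exact ⟨(0, fun l => t l • y), by simp [hg, mul_smul_comm]⟩

/-- Finite-dimensional homomorphic images of inverse limits of nilpotent finite-dimensional
algebras are nilpotent. -/
theorem IsInverseLimit.isNilpotentAlg_of_surjective {A : Type*} [NonUnitalNonAssocRing A]
    [Module k A] [IsScalarTower k A A] [SMulCommClass k A A] {I : Type*} [Preorder I]
    {F : I → Type*} [∀ i, NonUnitalNonAssocRing (F i)] [∀ i, Module k (F i)]
    [∀ i, IsScalarTower k (F i) (F i)] [∀ i, SMulCommClass k (F i) (F i)]
    {φ : ∀ ⦃i j : I⦄, i ≤ j → (F j →ₙₐ[k] F i)} {π : ∀ i, A →ₙₐ[k] F i}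
    (hlim : IsInverseLimit φ π) (hfin : ∀ i, Module.Finite k (F i))
    (hnil : ∀ i, IsNilpotentAlg k (F i)) [Module.Finite k B] (f : A →ₙₐ[k] B)
    (hf : Function.Surjective f) : IsNilpotentAlg k B := by
  refine isNilpotentAlg_of_forall_mulBoth fun C hC => ?_
  obtain ⟨r, c, rfl⟩ := Submodule.fg_iff_exists_fin_generating_family.1
    (IsNoetherian.noetherian C)
  have hsys := fun j => exists_eq_sum_of_mem_mulBoth c (x := c j)
    (hC.ge (Submodule.subset_span ⟨j, rfl⟩))
  choose b b' hb using hsys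
  obtain ⟨s, hs⟩ := hf.hasRightInverse
  -- Solve the system in `A` with coefficients and right side lifted along the section `s`, then
  -- apply `f`.
  have hsurj : Function.Surjective
      (LinearMap.id - mulSystem k b b' : (Fin r → B) →ₗ[k] (Fin r → B)) := fun y => by
    obtain ⟨x, hx⟩ := hlim.surjective_sub_mulSystem hfin hnil (fun j l => s (b j l))
      (fun j l => s (b' j l)) (fun j => s (y j))
    refine ⟨fun j => f (x j), funext fun j => ?_⟩
    have h1 := congrArg f (congrFun hx j)
    simp only [LinearMap.sub_apply, LinearMap.id_apply, Pi.sub_apply, map_sub, map_mulSystem,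
      hs _] at h1 ⊢
    exact h1
  -- On the finite-dimensional `Fin r → B`, surjectivity gives injectivity, and `c` lies in the
  -- kernel by `hb`.
  have hc : c = 0 := by
    apply LinearMap.injective_iff_surjective.2 hsurj
    rw [map_zero, LinearMap.sub_apply, sub_eq_zero]
    funext j
    rw [mulSystem_apply]
    exact hb j
  rw [hc, Submodule.span_eq_bot]
  rintro _ ⟨j, rfl⟩
  rfl

end NilpotentImages

end NonAssocAlg

theorem theorem4p1 {k : Type*} [Field k]
    (V : NonAssocAlg.Variety k) (hV : V.IsSeparative)
    {I : Type*} [Preorder I] [IsDirectedOrder I] [Nonempty I]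
    {F : I → Type*} [∀ i, NonUnitalNonAssocRing (F i)] [∀ i, Module k (F i)]
    [∀ i, IsScalarTower k (F i) (F i)] [∀ i, SMulCommClass k (F i) (F i)]
    (φ : ∀ ⦃i j : I⦄, i ≤ j → (F j →ₙₐ[k] F i))
    {A : Type*} [NonUnitalNonAssocRing A] [Module k A]
    [IsScalarTower k A A] [SMulCommClass k A A]
    (π : ∀ i, A →ₙₐ[k] F i)
    (hlim : NonAssocAlg.IsInverseLimit φ π)
    (hfin : ∀ i, Module.Finite k (F i))
    (hA : V.Mem A)
    (hdense : ∃ s : Finset A,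
      @Dense A (NonAssocAlg.inverseLimitTopology π)
        (NonUnitalAlgebra.adjoin k (s : Set A) : Set A)) :
    (∀ n : ℕ, 0 < n →
      IsOpen[NonAssocAlg.inverseLimitTopology π] (NonAssocAlg.lowerPower k A n : Set A)) ∧
    (∀ (B : Type*) [NonUnitalNonAssocRing B] [Module k B]
      [IsScalarTower k B B] [SMulCommClass k B B],
      NonAssocAlg.IsNilpotentAlg k B →
      ∀ f : A →ₙₐ[k] B, Continuous[NonAssocAlg.inverseLimitTopology π, ⊥] f) ∧
    ((∀ i, NonAssocAlg.IsNilpotentAlg k (F i)) →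
      ∀ (B : Type*) [NonUnitalNonAssocRing B] [Module k B]
        [IsScalarTower k B B] [SMulCommClass k B B],
        Module.Finite k B →
        ∀ f : A →ₙₐ[k] B, Continuous[NonAssocAlg.inverseLimitTopology π, ⊥] f) := by
  refine ⟨fun n hn => ?_, fun B _ _ _ _ hB f => ?_, fun hnil B _ _ _ _ _ f => ?_⟩
  · obtain ⟨i, hi⟩ := NonAssocAlg.exists_ker_le_lowerPower hV hlim hfin hA hdense n hn
    exact NonAssocAlg.isOpen_of_ker_le π i hi
  · obtain ⟨i, hi⟩ :=
      NonAssocAlg.exists_ker_le_ker_of_isNilpotentAlg hV hlim hfin hA hdense hB f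
    exact NonAssocAlg.continuous_of_ker_le π i f hi
  -- `B` itself need not be nilpotent, but the image of `f` is, and corestricting `f` to it does not
  -- change the kernel.
  · let R : NonUnitalSubalgebra k B := NonUnitalAlgHom.range f
    have : Module.Finite k R := inferInstanceAs (Module.Finite k R.toSubmodule)
    let g : A →ₙₐ[k] R := NonUnitalAlgHom.rangeRestrict f
    have hg : Function.Surjective g := by
      rintro ⟨_, x, rfl⟩
      exact ⟨x, rfl⟩
    obtain ⟨i, hi⟩ := NonAssocAlg.exists_ker_le_ker_of_isNilpotentAlg hV hlim hfin hA hdense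
      (hlim.isNilpotentAlg_of_surjective hfin hnil g hg) g
    exact NonAssocAlg.continuous_of_ker_le π i f fun x hx => congrArg Subtype.val (hi x hx)
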